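/- Let $n\in\mathbb N$, let $X,Y$ be complex Banach spaces and let $\mathcal B$ be a family of compact subsets of $X$. A continuous function $G:\mathbb R^n\times X\to Y$ is called Bohr $\mathcal B$-almost periodic if for every $B\in\mathcal B$ and every $\varepsilon>0$ there is $l>0$ such that for each $\mathbf t_0\in\mathbb R^n$ there is $\tau\in\mathbb R^n$ with $|\tau-\mathbf t_0|\le l$ and $$\|G(\mathbf t+\tau;x)-G(\mathbf t;x)\|_Y\le\varepsilon\qquad\text{for all }\mathbf t\in\mathbb R^n,\ x\in B.$$ Let $F:\mathbb R^n\times X\to Y$ be continuous, and suppose that all partial derivatives $\partial F/\partial t_i$ ($1\le i\le n$) exist on $\mathbb R^n\times X$ and are Bohr $\mathcal B$-almost periodic. For $B\in\mathcal B$ let $l_\infty(B:Y)$ be the Banach space of all bounded functions $B\to Y$ with the sup-norm, and let $F_B:\mathbb R^n\to l_\infty(B:Y)$ be given by $[F_B(\mathbf t)](x)=F(\mathbf t;x)$. Assume that for each $B\in\mathcal B$ at least one of the following two conditions holds: (C1) the function $F_B$ is bounded and the Banach space $l_\infty(B:Y)$ does not contain a subspace isomorphic to $c_0$; (C2) the range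 of $F_B$ is weakly relatively compact in $l_\infty(B:Y)$. Then $F$ is Bohr $\mathcal B$-almost periodic. -/

import Mathlib

open scoped ENNReal ZeroAtInfty

/-- Bohr `𝓑`-almost periodicity of `F : ℝⁿ × X → Y`: the function `F` is continuous and, for every
`B ∈ 𝓑` and `ε > 0`, there is `l > 0` such that every closed Euclidean ball of radius `l` contains
some `τ` with `‖F (t + τ, x) - F (t, x)‖ ≤ ε` for all `t ∈ ℝⁿ` and `x ∈ B`. -/
def IsBohrAlmostPeriodic {n : ℕ} {X Y : Type*} [NormedAddCommGroup X] [NormedAddCommGroup Y]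
    (𝓑 : Set (Set X)) (F : EuclideanSpace ℝ (Fin n) × X → Y) : Prop :=
  Continuous F ∧
    ∀ B ∈ 𝓑, ∀ ε : ℝ, 0 < ε → ∃ l : ℝ, 0 < l ∧
      ∀ t₀ : EuclideanSpace ℝ (Fin n), ∃ τ ∈ Metric.closedBall t₀ l,
        ∀ t : EuclideanSpace ℝ (Fin n), ∀ x ∈ B, ‖F (t + τ, x) - F (t, x)‖ ≤ ε

/-- The space `E` contains a copy of `c₀`, the space of complex null sequences with the sup-norm:
there is a bounded linear map `c₀ → E` that is bounded below, that is, an isomorphism of `c₀` onto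
a (necessarily closed) subspace of `E`. -/
def ContainsC0 (E : Type*) [NormedAddCommGroup E] [NormedSpace ℂ E] : Prop :=
  ∃ T : C₀(ℕ, ℂ) →L[ℂ] E, ∃ c : ℝ, 0 < c ∧ ∀ u : C₀(ℕ, ℂ), c * ‖u‖ ≤ ‖T u‖

/-- The set `S` is weakly relatively compact in `E`: its closure in the weak topology `σ(E, E*)`
is weakly compact. -/
def IsWeaklyRelativelyCompact {E : Type*} [NormedAddCommGroup E] [NormedSpace ℂ E]
    (S : Set E) : Prop :=
  IsCompact (closure (toWeakSpace ℂ E '' S))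

/-- A continuous `F : ℝⁿ × X → Y` is bounded on `{t} × B` for compact `B`. -/
theorem memlp_infty_slice {n : ℕ} {X Y : Type*} [NormedAddCommGroup X] [NormedAddCommGroup Y]
    {F : EuclideanSpace ℝ (Fin n) × X → Y} (hF : Continuous F) {B : Set X} (hB : IsCompact B)
    (t : EuclideanSpace ℝ (Fin n)) :
    Memℓp (E := fun _ : B => Y) (fun x : B => F (t, (x : X))) ∞ := by
  have hc : Continuous fun x : X => ‖F (t, x)‖ := by fun_prop
  refine memℓp_infty ((hB.bddAbove_image hc.continuousOn).mono ?_)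
  rintro _ ⟨x, rfl⟩
  exact ⟨x, x.2, rfl⟩

/-- The map `F_B : ℝⁿ → l_∞(B : Y)`, `F_B(t)(x) = F(t, x)`, for continuous `F` and compact `B`.
Here `l_∞(B : Y)`, the Banach space of all bounded functions `B → Y` with the sup-norm, is
`lp (fun _ : B => Y) ∞`. -/
def sliceMap {n : ℕ} {X Y : Type*} [NormedAddCommGroup X] [NormedAddCommGroup Y]
    (F : EuclideanSpace ℝ (Fin n) × X → Y) (hF : Continuous F) (B : Set X) (hB : IsCompact B)
    (t : EuclideanSpace ℝ (Fin n)) : lp (fun _ : B => Y) ∞ :=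
  ⟨fun x : B => F (t, (x : X)), memlp_infty_slice hF hB t⟩

/-! This is the Bohl–Bohr–Kadets theorem applied to `F_B`. Common almost periods of the partial
derivatives, with the mean value inequality, make the differences `F_B(· + r) - F_B` almost periodic
uniformly for `r` in a ball. If `F_B` itself were not almost periodic, `exists_seq_almost_additive`
would give shifts `σ k` whose increments `x k = F_B (σ k) - F_B 0` are bounded away from zero, while
`F_B` of a finite subsum of shifts is `F_B 0` plus the increments, up to a small error. Boundedness
of `F_B` then bounds all finite subsums of the increments, and Rosenthal's lemma extracts a
subsequence with almost biorthogonal norming functionals `φ i`.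

Under (C1), `u ↦ ∑ u i • x i` embeds `c₀`, a contradiction. Under (C2), let `w k` be `F_B` at the
`k`-th partial sum of shifts: `φ i (w k - F_B 0)` has small real part for `k ≤ i` and large real
part for `k > i`. A weak cluster point of `w` inherits the second bound for every `i`, but lies in
the closed convex hull of `w`, where the first must hold for some `i`. -/

/-! ### Bounded subsums, Rosenthal's lemma and copies of `c₀` -/

section SubsetSums

theorem Finset.sum_abs_le_two_mul_of_abs_sum_le {ι : Type*} (r : ι → ℝ) (S : Finset ι) {K : ℝ}
    (h : ∀ A ⊆ S, |∑ i ∈ A, r i| ≤ K) : ∑ i ∈ S, |r i| ≤ 2 * K := by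
  classical
  rw [← Finset.sum_filter_add_sum_filter_not S (fun i => 0 ≤ r i)]
  have h1 : ∑ i ∈ S with 0 ≤ r i, |r i| = ∑ i ∈ S with 0 ≤ r i, r i :=
    Finset.sum_congr rfl fun i hi => abs_of_nonneg (Finset.mem_filter.1 hi).2
  have h2 : ∑ i ∈ S with ¬ 0 ≤ r i, |r i| = -∑ i ∈ S with ¬ 0 ≤ r i, r i := by
    rw [← Finset.sum_neg_distrib]
    exact Finset.sum_congr rfl fun i hi =>
      abs_of_neg (not_le.1 (Finset.mem_filter.1 hi).2)
  have h3 := (le_abs_self _).trans (h _ (Finset.filter_subset (fun i => 0 ≤ r i) S))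
  have h4 := (neg_le_abs _).trans (h _ (Finset.filter_subset (fun i => ¬ 0 ≤ r i) S))
  rw [h1, h2]
  linarith

theorem Finset.sum_norm_le_four_mul_of_norm_sum_le {ι : Type*} (z : ι → ℂ) (S : Finset ι) {K : ℝ}
    (h : ∀ A ⊆ S, ‖∑ i ∈ A, z i‖ ≤ K) : ∑ i ∈ S, ‖z i‖ ≤ 4 * K := by
  have h1 := Finset.sum_abs_le_two_mul_of_abs_sum_le (fun i => (z i).re) S (K := K) fun A hA => by
    rw [← Complex.re_sum]
    exact (Complex.abs_re_le_norm _).trans (h A hA)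
  have h2 := Finset.sum_abs_le_two_mul_of_abs_sum_le (fun i => (z i).im) S (K := K) fun A hA => by
    rw [← Complex.im_sum]
    exact (Complex.abs_im_le_norm _).trans (h A hA)
  calc ∑ i ∈ S, ‖z i‖ ≤ ∑ i ∈ S, (|(z i).re| + |(z i).im|) :=
        Finset.sum_le_sum fun i _ => Complex.norm_le_abs_re_add_abs_im _
    _ ≤ 4 * K := by rw [Finset.sum_add_distrib]; linarith

/-- Rosenthal's lemma: an infinite nonnegative matrix whose off-diagonal row sums are bounded has
an infinite principal submatrix whose off-diagonal row sums are at most `δ`. -/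
theorem exists_injective_forall_sum_le {δ : ℝ} (hδ : 0 < δ) (m : ℕ) (a : ℕ → ℕ → ℝ)
    (ha : ∀ i (S : Finset ℕ), i ∉ S → ∑ j ∈ S, a i j ≤ m * δ) :
    ∃ n : ℕ → ℕ, Function.Injective n ∧
      ∀ i (S : Finset ℕ), i ∉ S → ∑ j ∈ S, a (n i) (n j) ≤ δ := by
  induction m generalizing a with
  | zero =>
    refine ⟨id, Function.injective_id, fun i S hi => (ha i S hi).trans ?_⟩
    simpa using hδ.le
  | succ m ih =>
    -- `Nat.pair p` enumerates the `p`-th of infinitely many disjoint blocks. If every block has a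
    -- bad row, one bad row per block gives a submatrix: the mass above `δ` inside the block lowers
    -- the bound for the rest to `m * δ`.
    by_cases hp : ∃ p, ∀ i (S : Finset ℕ), i ∉ S →
        ∑ j ∈ S, a (Nat.pair p i) (Nat.pair p j) ≤ δ
    · obtain ⟨p, hp⟩ := hp
      exact ⟨Nat.pair p, fun i j hij => (Nat.pair_eq_pair.1 hij).2, hp⟩
    push Not at hp
    choose k S hkS hS using hp
    have hinj : Function.Injective fun p => Nat.pair p (k p) :=
      fun p q hpq => (Nat.pair_eq_pair.1 hpq).1
    obtain ⟨n, hn, hn'⟩ := ih (fun p q => a (Nat.pair p (k p)) (Nat.pair q (k q))) fun p U hU => by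
      have hpinj : Function.Injective (Nat.pair p) := fun i j hij => (Nat.pair_eq_pair.1 hij).2
      have hdisj : Disjoint (U.map ⟨_, hinj⟩) ((S p).map ⟨_, hpinj⟩) := by
        rw [Finset.disjoint_left]
        simp only [Finset.mem_map, Function.Embedding.coeFn_mk, not_exists, not_and]
        rintro _ ⟨q, hq, rfl⟩ j hj hjq
        rw [Nat.pair_eq_pair] at hjq
        exact hU (hjq.1 ▸ hq)
      have hnot : Nat.pair p (k p) ∉ (U.map ⟨_, hinj⟩).disjUnion ((S p).map ⟨_, hpinj⟩) hdisj := by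
        simp only [Finset.mem_disjUnion, Finset.mem_map, Function.Embedding.coeFn_mk,
          Nat.pair_eq_pair, not_or, not_exists, not_and]
        exact ⟨fun q hq hqp => absurd (hqp ▸ hq) hU, fun j hj _ hjk => hkS p (hjk ▸ hj)⟩
      have h1 := ha _ _ hnot
      rw [Finset.sum_disjUnion, Finset.sum_map, Finset.sum_map] at h1
      have h2 := hS p
      simp only [Function.Embedding.coeFn_mk] at h1
      push_cast at h1
      linarith
    exact ⟨fun i => Nat.pair (n i) (k (n i)), hinj.comp hn, hn'⟩

variable {E : Type*} [NormedAddCommGroup E] [NormedSpace ℂ E]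

theorem sum_norm_dual_apply_le {ι : Type*} {x : ι → E} {M : ℝ}
    (hM : ∀ A : Finset ι, ‖∑ i ∈ A, x i‖ ≤ M) {φ : StrongDual ℂ E} (hφ : ‖φ‖ ≤ 1)
    (S : Finset ι) : ∑ i ∈ S, ‖φ (x i)‖ ≤ 4 * M := by
  refine Finset.sum_norm_le_four_mul_of_norm_sum_le _ S fun A _ => ?_
  rw [← map_sum]
  exact (φ.le_of_opNorm_le hφ _).trans (by simpa using hM A)

/-- A sequence bounded away from zero all of whose finite subsums are bounded has a subsequence
that is almost biorthogonal to a sequence of norming functionals. -/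
theorem exists_injective_almost_biorthogonal {x : ℕ → E} {M δ : ℝ} (hδ : 0 < δ)
    (hM : ∀ A : Finset ℕ, ‖∑ i ∈ A, x i‖ ≤ M) :
    ∃ (n : ℕ → ℕ) (φ : ℕ → StrongDual ℂ E), Function.Injective n ∧ (∀ i, ‖φ i‖ ≤ 1) ∧
      (∀ i, φ i (x (n i)) = (‖x (n i)‖ : ℂ)) ∧
      ∀ i (S : Finset ℕ), i ∉ S → ∑ j ∈ S, ‖φ i (x (n j))‖ ≤ δ := by
  choose ψ hψ hψx using fun i => exists_dual_vector'' ℂ (x i)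
  obtain ⟨m, hm⟩ := exists_nat_ge (4 * M / δ)
  rw [div_le_iff₀ hδ] at hm
  obtain ⟨n, hn, h⟩ := exists_injective_forall_sum_le hδ m (fun i j => ‖ψ i (x j)‖)
    fun i S _ => (sum_norm_dual_apply_le hM (hψ i) S).trans hm
  exact ⟨n, fun i => ψ (n i), hn, fun i => hψ _, fun i => hψx _, h⟩

theorem norm_sum_smul_le {ι : Type*} {x : ι → E} {M : ℝ}
    (hM : ∀ A : Finset ι, ‖∑ i ∈ A, x i‖ ≤ M) {R : ℝ} (hR : 0 ≤ R) (S : Finset ι) (a : ι → ℂ)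
    (ha : ∀ i ∈ S, ‖a i‖ ≤ R) : ‖∑ i ∈ S, a i • x i‖ ≤ R * (4 * M) := by
  obtain ⟨φ, hφ, hφx⟩ := exists_dual_vector'' ℂ (∑ i ∈ S, a i • x i)
  have h1 : ‖∑ i ∈ S, a i • x i‖ = ‖φ (∑ i ∈ S, a i • x i)‖ := by rw [hφx]; simp
  rw [h1, map_sum]
  calc ‖∑ i ∈ S, φ (a i • x i)‖ ≤ ∑ i ∈ S, R * ‖φ (x i)‖ := by
        refine norm_sum_le_of_le _ fun i hi => ?_
        rw [map_smul, norm_smul]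
        exact mul_le_mul_of_nonneg_right (ha i hi) (norm_nonneg _)
    _ ≤ R * (4 * M) := by
        rw [← Finset.mul_sum]
        exact mul_le_mul_of_nonneg_left (sum_norm_dual_apply_le hM hφ S) hR

theorem summable_zeroAtInfty_smul [CompleteSpace E] {x : ℕ → E} {M : ℝ}
    (hM : ∀ A : Finset ℕ, ‖∑ i ∈ A, x i‖ ≤ M) (u : C₀(ℕ, ℂ)) :
    Summable fun i => u i • x i := by
  have hM0 : 0 ≤ M := (norm_nonneg _).trans (hM ∅)
  rw [summable_iff_vanishing_norm]
  intro ε hε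
  have hη : 0 < ε / (4 * M + 1) := by positivity
  have hu : Filter.Tendsto u Filter.cofinite (nhds 0) := by
    rw [← Filter.cocompact_eq_cofinite]
    exact u.zero_at_infty'
  have hfin : {i | ¬ ‖u i‖ < ε / (4 * M + 1)}.Finite := by
    have := hu.norm.eventually (gt_mem_nhds (by simpa using hη))
    exact this
  refine ⟨hfin.toFinset, fun S hS => ?_⟩
  refine (norm_sum_smul_le hM hη.le S u fun i hi => ?_).trans_lt ?_
  · by_contra hlt
    exact Finset.disjoint_left.1 hS hi (by simpa using (not_le.1 hlt).le)
  · rw [div_mul_eq_mul_div, div_lt_iff₀ (by positivity)]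
    nlinarith

/-- For `T u = ∑ u i • x i`, testing against `φ i` recovers `u i` up to an error `θ / 4 * ‖u‖`. The
supremum over `i` gives the lower bound `3 * θ / 4`, more than the `θ / 2` used. -/
theorem containsC0_of_almost_biorthogonal [CompleteSpace E] {x : ℕ → E} {M θ : ℝ} (hθ : 0 < θ)
    (hM : ∀ A : Finset ℕ, ‖∑ i ∈ A, x i‖ ≤ M) (φ : ℕ → StrongDual ℂ E) (hφ : ∀ i, ‖φ i‖ ≤ 1)
    (hx : ∀ i, θ ≤ ‖φ i (x i)‖)
    (hS : ∀ i (S : Finset ℕ), i ∉ S → ∑ j ∈ S, ‖φ i (x j)‖ ≤ θ / 4) : ContainsC0 E := by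
  have hnorm : ∀ (u : C₀(ℕ, ℂ)) i, ‖u i‖ ≤ ‖u‖ := fun u i => by
    rw [← ZeroAtInftyContinuousMap.norm_toBCF_eq_norm]
    exact u.toBCF.norm_coe_le_norm i
  have hsum := summable_zeroAtInfty_smul hM
  let T₀ : C₀(ℕ, ℂ) →ₗ[ℂ] E :=
    { toFun := fun u => ∑' i, u i • x i
      map_add' := fun u v => by
        rw [← (hsum u).tsum_add (hsum v)]
        simp [add_smul]
      map_smul' := fun c u => by
        simp only [RingHom.id_apply]
        rw [← (hsum u).tsum_const_smul c]
        simp [mul_smul] }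
  have hT₀ : ∀ u, ‖T₀ u‖ ≤ 4 * M * ‖u‖ := fun u => by
    rw [mul_comm]
    exact le_of_tendsto (hsum u).hasSum.norm (Filter.Eventually.of_forall fun S =>
      norm_sum_smul_le hM (norm_nonneg u) S u fun i _ => hnorm u i)
  refine ⟨T₀.mkContinuous _ hT₀, θ / 2, by positivity, fun u => ?_⟩
  rw [LinearMap.mkContinuous_apply]
  have key : ∀ i, θ * ‖u i‖ ≤ ‖T₀ u‖ + θ / 4 * ‖u‖ := fun i => by
    rw [← sub_le_iff_le_add]
    refine ge_of_tendsto (hsum u).hasSum.norm ?_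
    filter_upwards [Filter.eventually_ge_atTop {i}] with S hiS
    have hi : i ∈ S := by simpa using hiS
    have h1 : ‖φ i (∑ j ∈ S, u j • x j)‖ ≤ ‖∑ j ∈ S, u j • x j‖ := by
      simpa using (φ i).le_of_opNorm_le (hφ i) (∑ j ∈ S, u j • x j)
    have h2 : ‖∑ j ∈ S.erase i, u j * φ i (x j)‖ ≤ θ / 4 * ‖u‖ := by
      calc _ ≤ ∑ j ∈ S.erase i, ‖φ i (x j)‖ * ‖u‖ := by
            refine norm_sum_le_of_le _ fun j _ => ?_
            rw [norm_mul, mul_comm]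
            exact mul_le_mul_of_nonneg_left (hnorm u j) (norm_nonneg _)
        _ ≤ _ := by
            rw [← Finset.sum_mul]
            exact mul_le_mul_of_nonneg_right (hS i _ (Finset.notMem_erase i S)) (norm_nonneg _)
    have h3 : φ i (∑ j ∈ S, u j • x j) = u i * φ i (x i) + ∑ j ∈ S.erase i, u j * φ i (x j) := by
      rw [map_sum, ← Finset.add_sum_erase S _ hi]
      simp
    have h4 : θ * ‖u i‖ ≤ ‖u i * φ i (x i)‖ := by
      rw [norm_mul, mul_comm]
      exact mul_le_mul_of_nonneg_left (hx i) (norm_nonneg _)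
    have h5 := norm_sub_norm_le (u i * φ i (x i)) (-∑ j ∈ S.erase i, u j * φ i (x j))
    rw [sub_neg_eq_add, norm_neg, ← h3] at h5
    linarith
  have hle : ‖u‖ ≤ (‖T₀ u‖ + θ / 4 * ‖u‖) / θ := by
    rw [← ZeroAtInftyContinuousMap.norm_toBCF_eq_norm,
      BoundedContinuousFunction.norm_le (by positivity)]
    intro i
    rw [le_div_iff₀ hθ, mul_comm, ZeroAtInftyContinuousMap.norm_toBCF_eq_norm]
    exact key i
  rw [le_div_iff₀ hθ] at hle
  nlinarith [norm_nonneg u, norm_nonneg (T₀ u)]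

end SubsetSums

/-! ### Weakly relatively compact sets -/

section WeakCompactness

variable {E : Type*} [NormedAddCommGroup E] [NormedSpace ℂ E]

theorem IsWeaklyRelativelyCompact.isBounded {S : Set E} (hS : IsWeaklyRelativelyCompact S) :
    Bornology.IsBounded S := by
  have h : ∀ φ : StrongDual ℂ E, ∃ C, ∀ s : S,
      ‖NormedSpace.inclusionInDoubleDual ℂ E (s : E) φ‖ ≤ C := fun φ => by
    have hc : Continuous fun w : WeakSpace ℂ E => φ ((toWeakSpace ℂ E).symm w) :=
      WeakBilin.eval_continuous _ φ
    obtain ⟨C, hC⟩ := (hS.image hc).isBounded.exists_norm_le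
    exact ⟨C, fun s => hC _ ⟨_, subset_closure ⟨s, s.2, rfl⟩, by simp⟩⟩
  obtain ⟨C, hC⟩ := banach_steinhaus h
  refine isBounded_iff_forall_norm_le.2 ⟨C, fun s hs => ?_⟩
  have := hC ⟨s, hs⟩
  rwa [(NormedSpace.inclusionInDoubleDualLi ℂ (E := E)).norm_map s |>.symm]

/-- A sequence in a weakly relatively compact set has a weak cluster point, which lies in the
closed convex hull of the sequence. -/
theorem IsWeaklyRelativelyCompact.exists_weak_cluster_point {S : Set E}
    (hS : IsWeaklyRelativelyCompact S) {w : ℕ → E} (hw : ∀ k, w k ∈ S) :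
    ∃ z ∈ closure (convexHull ℝ (Set.range w)), ∀ (φ : StrongDual ℂ E) (c : ℝ),
      (∀ᶠ k in Filter.atTop, c ≤ (φ (w k)).re) → c ≤ (φ z).re := by
  obtain ⟨z, -, hz⟩ := hS.exists_mapClusterPt (f := Filter.atTop)
    (u := fun k => toWeakSpace ℂ E (w k))
    (Filter.tendsto_principal.2 (Filter.Eventually.of_forall fun k =>
      subset_closure (Set.mem_image_of_mem _ (hw k))))
  have hcl : z ∈ closure (toWeakSpace ℂ E '' convexHull ℝ (Set.range w)) := by
    refine isClosed_closure.mem_of_mapClusterPt hz (Filter.Eventually.of_forall fun k =>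
      subset_closure (Set.mem_image_of_mem _ (subset_convexHull ℝ _ (Set.mem_range_self k))))
  -- Mazur: weak and norm closures of a convex set agree.
  rw [← (convex_convexHull ℝ (Set.range w)).toWeakSpace_closure ℂ] at hcl
  obtain ⟨z, hz', rfl⟩ := hcl
  refine ⟨z, hz', fun φ c hc => ?_⟩
  have hcont : Continuous fun w : WeakSpace ℂ E => (φ ((toWeakSpace ℂ E).symm w)).re :=
    Complex.continuous_re.comp (WeakBilin.eval_continuous _ φ)
  have := ((isClosed_Ici (a := c)).preimage hcont).mem_of_mapClusterPt hz
    (hc.mono fun k hk => by simpa using hk)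
  simpa using this

end WeakCompactness

/-! ### Almost periods of functions and of their differences -/

section AlmostPeriods

variable {V E : Type*} [NormedAddCommGroup V] [NormedAddCommGroup E]

/-- Every closed ball of some fixed radius meets `S`. -/
def IsRelativelyDense (S : Set V) : Prop :=
  ∃ l : ℝ, 0 < l ∧ ∀ t₀ : V, ∃ τ ∈ Metric.closedBall t₀ l, τ ∈ S

theorem IsRelativelyDense.mono {S T : Set V} (hS : IsRelativelyDense S) (h : S ⊆ T) :
    IsRelativelyDense T := by
  obtain ⟨l, hl, H⟩ := hS
  exact ⟨l, hl, fun t₀ => (H t₀).imp fun _ hτ => ⟨hτ.1, h hτ.2⟩⟩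

/-- The `δ`-almost periods of `g`. -/
def almostPeriods (g : V → E) (δ : ℝ) : Set V :=
  {τ | ∀ t, ‖g (t + τ) - g t‖ ≤ δ}

/-- The common `δ`-almost periods of the differences `g (· + r) - g`, `‖r‖ ≤ R`. -/
def differencePeriods (g : V → E) (R δ : ℝ) : Set V :=
  {τ | ∀ r, ‖r‖ ≤ R → ∀ t, ‖(g (t + r + τ) - g (t + τ)) - (g (t + r) - g t)‖ ≤ δ}

theorem differencePeriods_mono (g : V → E) {R R' δ δ' : ℝ} (hR : R' ≤ R) (hδ : δ ≤ δ') :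
    differencePeriods g R δ ⊆ differencePeriods g R' δ' :=
  fun _ hτ r hr t => (hτ r (hr.trans hR) t).trans hδ

theorem add_mem_differencePeriods {g : V → E} {R δ δ' : ℝ} {τ σ : V}
    (hτ : τ ∈ differencePeriods g R δ) (hσ : σ ∈ differencePeriods g R δ') :
    τ + σ ∈ differencePeriods g R (δ + δ') := fun r hr t => by
  have h1 := hτ r hr t
  have h2 := hσ r hr (t + τ)
  rw [add_right_comm t τ r] at h2
  refine le_trans (le_of_eq ?_) (norm_add_le_of_le h1 h2)
  rw [← add_assoc, ← add_assoc]
  congr 1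
  abel

section Joint

variable [ProperSpace V]

theorem uniformContinuous_of_almostPeriods {g : V → E} (hg : Continuous g)
    (hap : ∀ ε : ℝ, 0 < ε → IsRelativelyDense (almostPeriods g ε)) : UniformContinuous g := by
  rw [Metric.uniformContinuous_iff]
  intro ε hε
  obtain ⟨l, hl, H⟩ := hap (ε / 4) (by positivity)
  have huc := (isCompact_closedBall (0 : V) (l + 1)).uniformContinuousOn_of_continuous
    hg.continuousOn
  rw [Metric.uniformContinuousOn_iff] at huc
  obtain ⟨δ, hδ, hδ'⟩ := huc (ε / 4) (by positivity)
  -- An almost period near `-a` carries `a` into the ball of radius `l`; the cap `1` keeps `b`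
  -- within `l + 1`.
  refine ⟨min δ 1, by positivity, fun {a b} hab => ?_⟩
  obtain ⟨τ, hτ, hτ'⟩ := H (-a)
  have ha : ‖a + τ‖ ≤ l := by
    rwa [Metric.mem_closedBall, dist_eq_norm, sub_neg_eq_add, add_comm] at hτ
  have hba : ‖b - a‖ < 1 := by
    rw [← dist_eq_norm, dist_comm]; exact hab.trans_le (min_le_right _ _)
  have hb : ‖b + τ‖ ≤ l + 1 := by
    calc ‖b + τ‖ = ‖(a + τ) + (b - a)‖ := by congr 1; abel
      _ ≤ l + 1 := norm_add_le_of_le ha hba.le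
  have h1 := hδ' (a + τ) (by simpa using ha.trans (by linarith)) (b + τ) (by simpa using hb)
    (by simpa using hab.trans_le (min_le_left _ _))
  have h2 := hτ' a
  have h3 := hτ' b
  rw [← dist_eq_norm] at h2 h3
  have h4 := dist_triangle4 (g a) (g (a + τ)) (g (b + τ)) (g b)
  rw [dist_comm (g a) (g (a + τ))] at h4
  linarith

/-- Bochner's criterion: the translates of an almost periodic function are totally bounded. -/
theorem exists_finite_net_translates {g : V → E} (hg : Continuous g)
    (hap : ∀ ε : ℝ, 0 < ε → IsRelativelyDense (almostPeriods g ε)) {ε : ℝ} (hε : 0 < ε) :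
    ∃ C : Set V, C.Finite ∧ ∀ t, ∃ c ∈ C, ∀ u, ‖g (u + t) - g (u + c)‖ ≤ ε := by
  obtain ⟨δ, hδ, hδ'⟩ := Metric.uniformContinuous_iff.1
    (uniformContinuous_of_almostPeriods hg hap) (ε / 2) (by positivity)
  obtain ⟨l, hl, H⟩ := hap (ε / 2) (by positivity)
  obtain ⟨C, hC, hcov⟩ := Metric.totallyBounded_iff.1
    (isCompact_closedBall (0 : V) l).totallyBounded δ hδ
  refine ⟨C, hC, fun t => ?_⟩
  obtain ⟨τ, hτ, hτ'⟩ := H t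
  have hr : t - τ ∈ Metric.closedBall (0 : V) l := by
    rwa [mem_closedBall_zero_iff, ← dist_eq_norm, dist_comm]
  obtain ⟨c, hc, hrc⟩ := Set.mem_iUnion₂.1 (hcov hr)
  refine ⟨c, hc, fun u => ?_⟩
  have h1 := hτ' (u + (t - τ))
  have h2 := hδ' (a := u + (t - τ)) (b := u + c) (by simpa using hrc)
  rw [show u + (t - τ) + τ = u + t by abel] at h1
  rw [dist_eq_norm] at h2
  have h3 := norm_sub_le_norm_sub_add_norm_sub (g (u + t)) (g (u + (t - τ))) (g (u + c))
  linarith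

/-- Finitely many almost periodic functions have relatively dense common almost periods. -/
theorem isRelativelyDense_iInter_almostPeriods {ι : Type*} [Finite ι] {g : ι → V → E}
    (hg : ∀ i, Continuous (g i))
    (hap : ∀ i, ∀ ε : ℝ, 0 < ε → IsRelativelyDense (almostPeriods (g i) ε)) {ε : ℝ} (hε : 0 < ε) :
    IsRelativelyDense (⋂ i, almostPeriods (g i) ε) := by
  choose C hC c hcC hc using fun i =>
    exists_finite_net_translates (hg i) (hap i) (half_pos hε)
  -- If `κ s = κ t₀`, then `t₀ - s` is a common almost period. Only finitely many tuples occur, so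
  -- the representatives `s` stay bounded.
  let κ : V → ι → V := fun t i => c i t
  have hκ : (Set.range κ).Finite :=
    (Set.Finite.pi' hC).subset (by rintro _ ⟨t, rfl⟩ i; exact hcC i t)
  have : Finite (Set.range κ) := hκ
  obtain ⟨l, hl⟩ := (Set.finite_range (Set.rangeSplitting κ)).isBounded.exists_norm_le
  refine ⟨max l 1, by positivity, fun t₀ => ?_⟩
  set s := Set.rangeSplitting κ ⟨κ t₀, t₀, rfl⟩ with hs
  have hκs : κ s = κ t₀ := Set.apply_rangeSplitting κ _
  refine ⟨t₀ - s, ?_, Set.mem_iInter.2 fun i t => ?_⟩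
  · rw [Metric.mem_closedBall, dist_eq_norm, sub_sub_cancel_left, norm_neg]
    exact (hl s (Set.mem_range_self _)).trans (le_max_left _ _)
  · have h1 := hc i t₀ (t - s)
    have h2 := hc i s (t - s)
    rw [show c i s = c i t₀ from congrFun hκs i, sub_add_cancel] at h2
    rw [show t - s + t₀ = t + (t₀ - s) by abel] at h1
    rw [norm_sub_rev] at h2
    have h3 := norm_sub_le_norm_sub_add_norm_sub (g i (t + (t₀ - s))) (g i (t - s + c i t₀)) (g i t)
    linarith

end Joint

/-- Some difference period `τ` moves `f` by more than `ε` at some `t`. Taking a difference period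
`p` near `t`, `τ` moves `f` by more than `ε / 2` at `p`, so `p` or `p + τ` is far from `0` in value.
-/
theorem exists_far_differencePeriod {f : V → E} {ε δ R : ℝ} (hδ : 0 < δ) (hδε : δ ≤ ε)
    (hf : ∀ R δ : ℝ, 0 < δ → IsRelativelyDense (differencePeriods f R δ))
    (hε : ¬ IsRelativelyDense (almostPeriods f ε)) :
    ∃ σ ∈ differencePeriods f R δ, ε / 4 ≤ ‖f σ - f 0‖ := by
  obtain ⟨l, hl, H⟩ := hf R (δ / 2) (by positivity)
  have hnot : ¬ differencePeriods f (max R l) (δ / 2) ⊆ almostPeriods f ε := fun h =>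
    hε ((hf _ _ (by positivity)).mono h)
  obtain ⟨τ, hτ, hτε⟩ := Set.not_subset.1 hnot
  obtain ⟨t, ht⟩ : ∃ t, ε < ‖f (t + τ) - f t‖ := by
    simpa [almostPeriods] using hτε
  obtain ⟨p, hp, hpQ⟩ := H t
  have h1 := hτ (t - p) (le_max_of_le_right (by
    rwa [← dist_eq_norm, dist_comm])) p
  rw [add_sub_cancel] at h1
  have hτR := differencePeriods_mono f (le_max_left R l) le_rfl hτ
  have hsum := add_mem_differencePeriods hpQ hτR
  rw [add_halves] at hsum
  by_cases hp4 : ε / 4 ≤ ‖f p - f 0‖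
  · exact ⟨p, differencePeriods_mono f le_rfl (by linarith) hpQ, hp4⟩
  refine ⟨p + τ, hsum, ?_⟩
  have h2 : ‖f (t + τ) - f t‖ ≤ δ / 2 + (‖f (p + τ) - f 0‖ + ‖f p - f 0‖) := by
    refine le_trans (le_of_eq ?_) (norm_add_le_of_le h1
      (norm_sub_le (f (p + τ) - f 0) (f p - f 0)))
    congr 1
    abel
  linarith

/-- If `f` is not almost periodic but its differences are, then `f` is almost additive, up to a
constant, along the finite subsums of a sequence that stays away from the almost periods. -/
theorem exists_seq_almost_additive {f : V → E} {ε ρ : ℝ} (hε0 : 0 < ε) (hρ : 0 < ρ)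
    (hf : ∀ R δ : ℝ, 0 < δ → IsRelativelyDense (differencePeriods f R δ))
    (hε : ¬ IsRelativelyDense (almostPeriods f ε)) :
    ∃ σ : ℕ → V, (∀ k, ε / 4 ≤ ‖f (σ k) - f 0‖) ∧
      ∀ A : Finset ℕ, ‖f (∑ k ∈ A, σ k) - f 0 - ∑ k ∈ A, (f (σ k) - f 0)‖ ≤ ρ := by
  obtain ⟨δ, hδ, C, hC, hCρ⟩ := posSumOfEncodable (ε := min ε ρ) (by positivity) ℕ
  have hA : ∀ A : Finset ℕ, ∑ k ∈ A, δ k ≤ min ε ρ := fun A =>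
    (sum_le_hasSum A (fun k _ => (hδ k).le) hC).trans hCρ
  have hδε : ∀ k, δ k ≤ ε := fun k => by
    simpa using (hA {k}).trans (min_le_left _ _)
  choose s hs hs' using fun (k : ℕ) (R : ℝ) =>
    exists_far_differencePeriod (R := R) (hδ k) (hδε k) hf hε
  -- `R k` bounds every subsum of the shifts chosen before stage `k`, making it an admissible `r`
  -- for the next one.
  let R : ℕ → ℝ := fun k => Nat.rec 0 (fun k R => R + ‖s k R‖) k
  have hR : ∀ k, R k = ∑ j ∈ Finset.range k, ‖s j (R j)‖ := fun k => by
    induction k with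
    | zero => simp [R]
    | succ k ih => rw [Finset.sum_range_succ, ← ih]
  refine ⟨fun k => s k (R k), fun k => hs' _ _, fun A => ?_⟩
  refine le_trans ?_ ((hA A).trans (min_le_right _ _))
  induction A using Finset.induction_on_max with
  | empty => simp
  | insert k A hk ih =>
    have hkA : k ∉ A := fun h => lt_irrefl _ (hk k h)
    have hr : ‖∑ j ∈ A, s j (R j)‖ ≤ R k := by
      rw [hR k]
      exact (norm_sum_le _ _).trans (Finset.sum_le_sum_of_subset_of_nonneg
        (fun j hj => Finset.mem_range.2 (hk j hj)) fun _ _ _ => norm_nonneg _)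
    have h1 := hs k (R k) _ hr 0
    rw [Finset.sum_insert hkA, Finset.sum_insert hkA, Finset.sum_insert hkA]
    refine le_trans (le_of_eq ?_) (norm_add_le_of_le h1 ih)
    simp only [zero_add]
    rw [add_comm (∑ j ∈ A, s j (R j))]
    congr 1
    abel

end AlmostPeriods
-- The Bohl–Bohr–Kadets theorem
section Kadets

variable {V E : Type*} [NormedAddCommGroup V] [NormedAddCommGroup E] [NormedSpace ℂ E]

/-- The vectors satisfying the bound for all large `i` form a convex set; passing to its closure
costs `η`, as `‖φ i‖ ≤ 1`. -/
theorem re_le_of_mem_closure_convexHull {w : ℕ → E} {φ : ℕ → StrongDual ℂ E}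
    (hφ : ∀ i, ‖φ i‖ ≤ 1) {b : ℕ → ℝ} {c η : ℝ} (hη : 0 < η)
    (h : ∀ k i, k ≤ i → (φ i (w k)).re ≤ b i + c) {z : E}
    (hz : z ∈ closure (convexHull ℝ (Set.range w))) : ∃ i, (φ i z).re ≤ b i + c + η := by
  have hconv : Convex ℝ {v : E | ∃ K, ∀ i, K ≤ i → (φ i v).re ≤ b i + c} := by
    rintro v ⟨K, hK⟩ v' ⟨K', hK'⟩ α β hα hβ hαβ
    refine ⟨max K K', fun i hi => ?_⟩
    have h1 := mul_le_mul_of_nonneg_left (hK i (le_of_max_le_left hi)) hα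
    have h2 := mul_le_mul_of_nonneg_left (hK' i (le_of_max_le_right hi)) hβ
    have h3 : (φ i (α • v + β • v')).re = α * (φ i v).re + β * (φ i v').re := by
      rw [← Complex.coe_smul, ← Complex.coe_smul, map_add, map_smul, map_smul]
      simp
    rw [h3]
    calc _ ≤ α * (b i + c) + β * (b i + c) := add_le_add h1 h2
      _ = b i + c := by rw [← add_mul, hαβ, one_mul]
  obtain ⟨v, hv, hzv⟩ := Metric.mem_closure_iff.1 hz η hη
  obtain ⟨K, hK⟩ := convexHull_min (Set.range_subset_iff.2 fun k => by exact ⟨k, h k⟩) hconv hv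
  refine ⟨K, ?_⟩
  have h1 := (Complex.re_le_norm _).trans ((φ K).le_of_opNorm_le (hφ K) (z - v))
  rw [one_mul, ← dist_eq_norm, map_sub, Complex.sub_re] at h1
  have h2 := hK K le_rfl
  linarith

/-- The theorem of Bohl, Bohr and Kadets: a function with almost periodic differences is almost
periodic if it is bounded with values in a space without a copy of `c₀`, or if its range is weakly
relatively compact. -/
theorem isRelativelyDense_almostPeriods [CompleteSpace E] {f : V → E}
    (hf : ∀ R δ : ℝ, 0 < δ → IsRelativelyDense (differencePeriods f R δ))
    (hC : (¬ ContainsC0 E ∧ Bornology.IsBounded (Set.range f)) ∨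
      IsWeaklyRelativelyCompact (Set.range f)) {ε : ℝ} (hε : 0 < ε) :
    IsRelativelyDense (almostPeriods f ε) := by
  by_contra hnot
  have hbdd : Bornology.IsBounded (Set.range f) := hC.elim And.right fun h => h.isBounded
  obtain ⟨M, hM⟩ := hbdd.exists_norm_le
  obtain ⟨θ, hθ, rfl⟩ : ∃ θ : ℝ, 0 < θ ∧ ε = 4 * θ := ⟨ε / 4, by positivity, by ring⟩
  obtain ⟨σ, hσ, hadd⟩ := exists_seq_almost_additive hε (ρ := θ / 8) (by positivity) hf hnot
  have hsub : ∀ A : Finset ℕ, ‖∑ k ∈ A, (f (σ k) - f 0)‖ ≤ M + M + θ / 8 := fun A => by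
    have h1 := norm_sub_le_of_le (norm_sub_le_of_le (hM _ (Set.mem_range_self (∑ k ∈ A, σ k)))
      (hM _ (Set.mem_range_self 0))) (hadd A)
    rwa [sub_sub_cancel] at h1
  obtain ⟨n, φ, hn, hφ, hφx, hoff⟩ :=
    exists_injective_almost_biorthogonal (δ := θ / 4) (by positivity) hsub
  have hθx : ∀ i, θ ≤ ‖f (σ (n i)) - f 0‖ := fun i => by linarith [hσ (n i)]
  rcases hC with ⟨hc₀, -⟩ | hweak
  · refine hc₀ (containsC0_of_almost_biorthogonal (x := fun i => f (σ (n i)) - f 0)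
      (M := M + M + θ / 8) hθ
      (fun A => ?_) φ hφ (fun i => ?_) hoff)
    · simpa using hsub (A.map ⟨n, hn⟩)
    · rw [hφx]
      simpa using hθx i
  let w : ℕ → E := fun k => f (∑ j ∈ Finset.range k, σ (n j))
  have hw : ∀ i k, |(φ i (w k)).re - (φ i (f 0)).re -
      ∑ j ∈ Finset.range k, (φ i (f (σ (n j)) - f 0)).re| ≤ θ / 8 := fun i k => by
    have h1 := hadd ((Finset.range k).map ⟨n, hn⟩)
    rw [Finset.sum_map, Finset.sum_map] at h1
    have h2 := (Complex.abs_re_le_norm _).trans (((φ i).le_of_opNorm_le (hφ i) _).trans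
      ((one_mul _).trans_le h1))
    rwa [map_sub, map_sub, map_sum, Complex.sub_re, Complex.sub_re, Complex.re_sum] at h2
  have hoff' : ∀ i (S : Finset ℕ), i ∉ S →
      |∑ j ∈ S, (φ i (f (σ (n j)) - f 0)).re| ≤ θ / 4 := fun i S hi =>
    (Finset.abs_sum_le_sum_abs _ _).trans
      ((Finset.sum_le_sum fun j _ => Complex.abs_re_le_norm _).trans (hoff i S hi))
  obtain ⟨z, hz, hzφ⟩ := hweak.exists_weak_cluster_point (w := w) fun k => Set.mem_range_self _
  obtain ⟨i, hi⟩ := re_le_of_mem_closure_convexHull hφ (b := fun i => (φ i (f 0)).re)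
    -- For `k ≤ i` only off-diagonal terms occur: `θ / 4 + θ / 8 = 3 * θ / 8`.
    (c := 3 * θ / 8) (η := θ / 8) (by positivity) (fun k i hki => by
      have h1 := (abs_le.1 (hw i k)).2
      have h2 := (abs_le.1 (hoff' i (Finset.range k) (by simpa using hki))).2
      linarith) hz
  -- For `k > i` the diagonal term enters: `θ - θ / 4 - θ / 8 = 5 * θ / 8`, above the upper bound `θ
  -- / 2`.
  have h1 := hzφ (φ i) ((φ i (f 0)).re + 5 * θ / 8) <| by
    filter_upwards [Filter.eventually_gt_atTop i] with k hk
    have h1 := (abs_le.1 (hw i k)).1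
    rw [← Finset.add_sum_erase _ _ (Finset.mem_range.2 hk), hφx, Complex.ofReal_re] at h1
    have h2 := (abs_le.1 (hoff' i ((Finset.range k).erase i) (Finset.notMem_erase i _))).1
    have h3 := hθx i
    linarith
  linarith

end Kadets

/-! ### Mean value inequality from partial derivatives -/

section PartialDerivatives

variable {n : ℕ} {Y : Type*} [NormedAddCommGroup Y] [NormedSpace ℝ Y]

theorem norm_sub_le_of_hasLineDerivAt {V : Type*} [NormedAddCommGroup V] [NormedSpace ℝ V]
    {q q' : V → Y} {v : V} {η : ℝ} (hq : ∀ t, HasLineDerivAt ℝ q (q' t) t v)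
    (hη : ∀ t, ‖q' t‖ ≤ η) (t : V) (c : ℝ) : ‖q (t + c • v) - q t‖ ≤ η * |c| := by
  have hd : ∀ s : ℝ, HasDerivAt (fun s : ℝ => q (t + s • v)) (q' (t + s • v)) s := fun s => by
    have h := hq (t + s • v)
    rw [HasLineDerivAt] at h
    have h' : HasDerivAt (fun u : ℝ => q (t + s • v + u • v)) (q' (t + s • v)) (s - s) := by
      rwa [sub_self]
    have := h'.comp_sub_const s s
    convert this using 2 with u
    rw [add_assoc, ← add_smul, add_sub_cancel]
  have := convex_univ.norm_image_sub_le_of_norm_hasDerivWithin_le (s := Set.univ) (x := 0) (y := c)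
    (fun s _ => (hd s).hasDerivWithinAt) (fun s _ => hη _) (Set.mem_univ _) (Set.mem_univ _)
  simpa using this

/-- Moving one coordinate at a time avoids assuming total differentiability. -/
theorem norm_sub_le_of_partialDeriv_le {q : EuclideanSpace ℝ (Fin n) → Y}
    {q' : Fin n → EuclideanSpace ℝ (Fin n) → Y} {η : ℝ} (hη0 : 0 ≤ η)
    (hq : ∀ i t, HasLineDerivAt ℝ q (q' i t) t (EuclideanSpace.single i (1 : ℝ)))
    (hη : ∀ i t, ‖q' i t‖ ≤ η) (t r : EuclideanSpace ℝ (Fin n)) :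
    ‖q (t + r) - q t‖ ≤ n * η * ‖r‖ := by
  have key : ∀ S : Finset (Fin n),
      ‖q (t + ∑ i ∈ S, r i • EuclideanSpace.single i (1 : ℝ)) - q t‖ ≤ ∑ i ∈ S, η * |r i| := by
    intro S
    induction S using Finset.induction_on with
    | empty => simp
    | insert i S hi ih =>
      rw [Finset.sum_insert hi, Finset.sum_insert hi, add_comm (r i • _), ← add_assoc]
      exact (norm_sub_le_norm_sub_add_norm_sub _ _ _).trans (add_le_add
        (norm_sub_le_of_hasLineDerivAt (hq i) (hη i) _ _) ih)
  have hr : ∑ i, r i • EuclideanSpace.single i (1 : ℝ) = r := by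
    ext j
    simp [Pi.single_apply]
  have h1 := key Finset.univ
  rw [hr] at h1
  refine h1.trans ?_
  calc ∑ i, η * |r i| ≤ ∑ _i : Fin n, η * ‖r‖ :=
        Finset.sum_le_sum fun i _ =>
          mul_le_mul_of_nonneg_left (PiLp.norm_apply_le r i) hη0
    _ = n * η * ‖r‖ := by simp [mul_assoc]

end PartialDerivatives

/-! ### Transfer to the maps `F_B` -/

section SliceMap

variable {n : ℕ} {X Y : Type*} [NormedAddCommGroup X] [NormedAddCommGroup Y]
  {F : EuclideanSpace ℝ (Fin n) × X → Y} {B : Set X}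

theorem norm_sliceMap_sub_le_iff (hF : Continuous F) (hB : IsCompact B)
    {s t : EuclideanSpace ℝ (Fin n)} {c : ℝ} (hc : 0 ≤ c) :
    ‖sliceMap F hF B hB s - sliceMap F hF B hB t‖ ≤ c ↔ ∀ x ∈ B, ‖F (s, x) - F (t, x)‖ ≤ c := by
  refine ⟨fun h x hx => ?_, fun h => lp.norm_le_of_forall_le hc fun x => h x x.2⟩
  exact (lp.norm_apply_le_norm ENNReal.top_ne_zero
    (sliceMap F hF B hB s - sliceMap F hF B hB t) ⟨x, hx⟩).trans h

theorem continuous_sliceMap (hF : Continuous F) (hB : IsCompact B) :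
    Continuous (sliceMap F hF B hB) := by
  rw [Metric.continuous_iff']
  intro t ε hε
  have h : ∀ᶠ s in nhds t, ∀ x ∈ B, ‖F (s, x) - F (t, x)‖ < ε / 2 := by
    refine hB.eventually_forall_of_forall_eventually fun x _ => ?_
    have hc : Continuous fun p : EuclideanSpace ℝ (Fin n) × X => ‖F p - F (t, p.2)‖ := by
      fun_prop
    exact hc.continuousAt.eventually (gt_mem_nhds (by simpa using hε))
  filter_upwards [h] with s hs
  rw [dist_eq_norm]
  exact ((norm_sliceMap_sub_le_iff hF hB (half_pos hε).le).2 fun x hx => (hs x hx).le).trans_lt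
    (half_lt_self hε)

theorem mem_almostPeriods_sliceMap_iff (hF : Continuous F) (hB : IsCompact B)
    {τ : EuclideanSpace ℝ (Fin n)} {c : ℝ} (hc : 0 ≤ c) :
    τ ∈ almostPeriods (sliceMap F hF B hB) c ↔
      ∀ t, ∀ x ∈ B, ‖F (t + τ, x) - F (t, x)‖ ≤ c :=
  forall_congr' fun _ => norm_sliceMap_sub_le_iff hF hB hc

theorem isRelativelyDense_differencePeriods_sliceMap [NormedSpace ℝ Y] (hF : Continuous F)
    (hB : IsCompact B) {F' : Fin n → EuclideanSpace ℝ (Fin n) × X → Y}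
    (hF' : ∀ i t x, HasLineDerivAt ℝ (fun s => F (s, x)) (F' i (t, x)) t
      (EuclideanSpace.single i (1 : ℝ)))
    (hc : ∀ i, Continuous (F' i))
    (hap : ∀ i, ∀ ε : ℝ, 0 < ε → IsRelativelyDense (almostPeriods (sliceMap (F' i) (hc i) B hB) ε))
    (R δ : ℝ) (hδ : 0 < δ) : IsRelativelyDense (differencePeriods (sliceMap F hF B hB) R δ) := by
  have hη : 0 < δ / (n * |R| + 1) := by positivity
  refine (isRelativelyDense_iInter_almostPeriods (fun i => continuous_sliceMap (hc i) hB) hap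
    hη).mono fun τ hτ r hr t => lp.norm_le_of_forall_le hδ.le fun x => ?_
  have hτ' := fun i => (mem_almostPeriods_sliceMap_iff (hc i) hB hη.le).1 (Set.mem_iInter.1 hτ i)
  -- A common `η`-almost period `τ` of the partial derivatives makes those of `F (· + τ, x) - F (·,
  -- x)` at most `η`.
  have h1 := norm_sub_le_of_partialDeriv_le
    (q := fun s => F (s + τ, (x : X)) - F (s, (x : X)))
    (q' := fun i s => F' i (s + τ, (x : X)) - F' i (s, (x : X))) hη.le
    (fun i s => by
      have h2 := hF' i (s + τ) x
      have h3 := hF' i s x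
      rw [HasLineDerivAt] at h2 h3 ⊢
      simp only [add_right_comm s τ] at h2
      exact h2.sub h3)
    (fun i s => hτ' i s x x.2) t r
  change ‖(F (t + r + τ, (x : X)) - F (t + τ, (x : X))) - (F (t + r, (x : X)) - F (t, (x : X)))‖ ≤ δ
  rw [sub_sub_sub_comm]
  refine h1.trans ?_
  have hrR : ‖r‖ ≤ |R| := hr.trans (le_abs_self R)
  calc n * (δ / (n * |R| + 1)) * ‖r‖ ≤ n * (δ / (n * |R| + 1)) * |R| := by gcongr
    _ = δ * ((n * |R|) / (n * |R| + 1)) := by ring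
    _ ≤ δ * 1 := by
        gcongr
        exact div_le_one_of_le₀ (by linarith) (by positivity)
    _ = δ := mul_one δ

end SliceMap

theorem theorem2p29 {n : ℕ}
    {X : Type*} [NormedAddCommGroup X] [NormedSpace ℂ X] [CompleteSpace X]
    {Y : Type*} [NormedAddCommGroup Y] [NormedSpace ℂ Y] [CompleteSpace Y]
    (𝓑 : Set (Set X)) (h𝓑 : ∀ B ∈ 𝓑, IsCompact B)
    (F : EuclideanSpace ℝ (Fin n) × X → Y) (hF : Continuous F)
    -- `F' i` is the partial derivative of `F` with respect to `tᵢ`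
    (F' : Fin n → EuclideanSpace ℝ (Fin n) × X → Y)
    (hF' : ∀ (i : Fin n) (t : EuclideanSpace ℝ (Fin n)) (x : X),
      HasLineDerivAt ℝ (fun s : EuclideanSpace ℝ (Fin n) => F (s, x)) (F' i (t, x)) t
        (EuclideanSpace.single i (1 : ℝ)))
    (hap : ∀ i : Fin n, IsBohrAlmostPeriodic 𝓑 (F' i))
    (hC : ∀ (B : Set X) (hB : B ∈ 𝓑),
      (¬ ContainsC0 (lp (fun _ : B => Y) ∞) ∧
        Bornology.IsBounded (Set.range (sliceMap F hF B (h𝓑 B hB)))) ∨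
      IsWeaklyRelativelyCompact (Set.range (sliceMap F hF B (h𝓑 B hB)))) :
    IsBohrAlmostPeriodic 𝓑 F := by
  refine ⟨hF, fun B hB ε hε => ?_⟩
  have hB' := h𝓑 B hB
  have hap' : ∀ i, ∀ δ : ℝ, 0 < δ →
      IsRelativelyDense (almostPeriods (sliceMap (F' i) (hap i).1 B hB') δ) := fun i δ hδ => by
    obtain ⟨l, hl, H⟩ := (hap i).2 B hB δ hδ
    exact ⟨l, hl, fun t₀ => (H t₀).imp fun τ hτ =>
      ⟨hτ.1, (mem_almostPeriods_sliceMap_iff (hap i).1 hB' hδ.le).2 hτ.2⟩⟩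
  obtain ⟨l, hl, H⟩ := isRelativelyDense_almostPeriods
    (isRelativelyDense_differencePeriods_sliceMap hF hB' hF' (fun i => (hap i).1) hap')
    (hC B hB) hε
  exact ⟨l, hl, fun t₀ => (H t₀).imp fun τ hτ =>
    ⟨hτ.1, (mem_almostPeriods_sliceMap_iff hF hB' hε.le).1 hτ.2⟩⟩
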